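/- **Setting.** Let $\Gamma$ be a lattice (a set of sites) and let $\mathcal A$ be a quantum spin lattice system on $\Gamma$: a unital $C^*$-algebra with unital $*$-subalgebras $\mathcal A(I)$, one for each finite $I\subset\Gamma$, such that each $\mathcal A(I)$ is isomorphic to a full matrix algebra, $\mathcal A(I\cup J)=\mathcal A(I)\otimes\mathcal A(J)$ for disjoint finite $I,J$ (the isomorphism $\mathcal A(I)\otimes\mathcal A(J)\to\mathcal A(I\cup J)$ being $a\otimes b\mapsto ab$), and $\bigcup_I\mathcal A(I)$ is norm dense in $\mathcal A$. For an arbitrary $J\subset\Gamma$ let $\mathcal A(J)$ be the norm closure of $\bigcup_{\Lambda\subset J,\ |\Lambda|<\infty}\mathcal A(\Lambda)$. For a state $\psi$ of $\mathcal A$ and finite $I$, let $S_I(\psi)=-\mathrm{Tr}(D\log D)$, where $D$ is the density matrix (with respect to the matrix trace $\mathrm{Tr}$) of the restriction of $\psi$ to $\mathcal A(I)$. For $J\subset I^c$, finite or infinite, define the conditional entropy and the mutual entropy by $$\widetilde S_{I|J}(\psi)=\inf_{\Lambda\subset J,\ |\Lambda|<\infty}\{S_{I\cup\Lambda}(\psi)-S_\Lambda(\psi)\},\qquad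 I_\psi(I:J)=S_I(\psi)-\widetilde S_{I|J}(\psi).$$ A potential $\Phi$ assigns to each finite $K\subset\Gamma$ a self-adjoint $\Phi(K)\in\mathcal A(K)$. Put $H_I=\sum_{K\subset I}\Phi(K)$, and assume that for every finite $I$ the surface energy $$H_{\partial I}=\sum_{K\cap I\neq\emptyset,\ K\cap I^c\neq\emptyset}\Phi(K)$$ exists in $\mathcal A$, as the norm limit of the sums restricted to $K\subset\Lambda$ as the finite regions $\Lambda$ increase to $\Gamma$. A state $\varphi$ satisfies local thermodynamical stability (LTS) for $\Phi$ at inverse temperature $\beta>0$ if, for every finite $I$, $\widetilde F_I(\varphi)\le\widetilde F_I(\psi)$ for all states $\psi$ of $\mathcal A$ that agree with $\varphi$ on $\mathcal A(I^c)$, where $\widetilde F_I(\psi)=\psi(H_I+H_{\partial I})-\frac1\beta\widetilde S_{I|I^c}(\psi)$. **Theorem (thermal area law).** Let the state $\varphi$ of $\mathcal A$ satisfy LTS for $\Phi$ at inverse temperature $\beta>0$. For every finite $A\subset\Gamma$ there is a unique state $\varphi_A\otimes\varphi_{A^c}$ of $\mathcal A$ with $(\varphi_A\otimes\varphi_{A^c})(XY)=\varphi(X)\varphi(Y)$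 for $X\in\mathcal A(A)$, $Y\in\mathcal A(A^c)$, and for every finite or infinite $B\subset A^c$, $$I_\varphi(A:B)\le I_\varphi(A:A^c)\le\beta\,(\varphi_A\otimes\varphi_{A^c}-\varphi)(H_{\partial A})\le 2\beta\|H_{\partial A}\|.$$ Moreover, let the sites be labelled by $\Gamma\cong\mathbb Z^\nu$ with $\nu\ge1$, and let finite regions $A$ tend to infinity in the sense of van Hove: for every $a\in\{1,2,\dots\}^\nu$, if $n_a^-(A)$ and $n_a^+(A)$ denote the numbers of cells of the partition of $\mathbb Z^\nu$ into the translates of the box $\prod_i[0,a_i)$ by $(n_ia_i)_i$, $n\in\mathbb Z^\nu$, that are contained in $A$ and that meet $A$, respectively, then $n_a^-(A)\to\infty$ and $n_a^-(A)/n_a^+(A)\to1$. If $\|H_{\partial A}\|/|A|\to0$ along these regions, then $I_\varphi(A:A^c)/|A|\to0$ along them. -/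

import Mathlib

open Filter Topology
open scoped TensorProduct ComplexOrder

noncomputable section

/-- A quantum spin lattice system on the lattice `Γ`, realized on the unital C⋆-algebra `𝒜`:
every finite region `I` carries a full matrix algebra `loc I ⊆ 𝒜` (a unital ⋆-subalgebra), the local
algebras of disjoint finite regions form tensor products inside `𝒜`, and the union of all local
algebras is norm dense in `𝒜`. -/
structure QuantumSpinSystem (Γ : Type*) [DecidableEq Γ] (𝒜 : Type*) [CStarAlgebra 𝒜] where
  /-- The algebra `𝒜(I)` of the finite region `I`. -/
  loc : Finset Γ → StarSubalgebra ℂ 𝒜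
  /-- The matrix dimension `n_I`. -/
  dim : Finset Γ → ℕ
  /-- An identification of `𝒜(I)` with the full matrix algebra of size `n_I`. -/
  iso : ∀ I, loc I ≃⋆ₐ[ℂ] Matrix (Fin (dim I)) (Fin (dim I)) ℂ
  /-- `𝒜(I ∪ J) = 𝒜(I) ⊗ 𝒜(J)` for disjoint `I`, `J`: multiplication in `𝒜` induces an isomorphism
  of algebras (so in particular `𝒜(I)` and `𝒜(J)` commute). -/
  tensor : ∀ I J, Disjoint I J → ∃ e : (loc I ⊗[ℂ] loc J) ≃ₐ[ℂ] loc (I ∪ J),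
    ∀ (a : loc I) (b : loc J), (e (a ⊗ₜ[ℂ] b) : 𝒜) = (a : 𝒜) * (b : 𝒜)
  /-- The local elements are norm dense. -/
  dense : Dense (⋃ I : Finset Γ, (loc I : Set 𝒜))

/-- A state: a positive linear functional, normalized at the unit. -/
structure CStarState (𝒜 : Type*) [CStarAlgebra 𝒜] extends 𝒜 →ₗ[ℂ] ℂ where
  nonneg : ∀ a : 𝒜, 0 ≤ toLinearMap (star a * a)
  map_one : toLinearMap 1 = 1

instance {𝒜 : Type*} [CStarAlgebra 𝒜] : CoeFun (CStarState 𝒜) (fun _ => 𝒜 → ℂ) :=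
  ⟨fun φ => φ.toLinearMap⟩

namespace QuantumSpinSystem

variable {Γ : Type*} [DecidableEq Γ] {𝒜 : Type*} [CStarAlgebra 𝒜]

/-- The C⋆-algebra `𝒜(J)` of an arbitrary (finite or infinite) region `J`, as a set: the norm
closure of the (directed) union of the algebras of the finite subregions of `J`. -/
def region (S : QuantumSpinSystem Γ 𝒜) (J : Set Γ) : Set 𝒜 :=
  closure (⋃ (Λ : Finset Γ) (_ : (Λ : Set Γ) ⊆ J), (S.loc Λ : Set 𝒜))

/-- The density matrix of the restriction of `ψ` to `𝒜(I)` with respect to the matrix trace `Tr`,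
that is, the matrix `D` with `ψ X = Tr (D X)` for all `X ∈ 𝒜(I)`. -/
def densityMatrix (S : QuantumSpinSystem Γ 𝒜) (ψ : CStarState 𝒜) (I : Finset Γ) :
    Matrix (Fin (S.dim I)) (Fin (S.dim I)) ℂ :=
  Matrix.of fun i j => ψ ((S.iso I).symm (Matrix.single j i 1) : 𝒜)

/-- The von Neumann entropy `S_I(ψ) = - Tr (D log D)`, with `D` the density matrix of `ψ` on `I`;
`Real.negMulLog x = - x log x` is applied through the functional calculus. -/
def entropy (S : QuantumSpinSystem Γ 𝒜) (ψ : CStarState 𝒜) (I : Finset Γ) : ℝ :=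
  (cfc Real.negMulLog (S.densityMatrix ψ I)).trace.re

/-- The conditional entropy of `ψ` on the finite region `I` given the region `J`: the infimum over
the finite `Λ ⊆ J` of `S_{I ∪ Λ}(ψ) - S_Λ(ψ)`, taken in the extended reals, where it always
exists. -/
def condEntropy (S : QuantumSpinSystem Γ 𝒜) (ψ : CStarState 𝒜) (I : Finset Γ) (J : Set Γ) :
    EReal :=
  ⨅ (Λ : Finset Γ) (_ : (Λ : Set Γ) ⊆ J),
    ((S.entropy ψ (I ∪ Λ) - S.entropy ψ Λ : ℝ) : EReal)

/-- The mutual entropy `I_ψ(I : J)` of a finite region `I` and a region `J` disjoint from it. -/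
def mutualEntropy (S : QuantumSpinSystem Γ 𝒜) (ψ : CStarState 𝒜) (I : Finset Γ) (J : Set Γ) :
    EReal :=
  (S.entropy ψ I : EReal) - S.condEntropy ψ I J

/-- A potential: a self-adjoint element of `𝒜(K)` for every finite region `K`. -/
structure Potential (S : QuantumSpinSystem Γ 𝒜) where
  val : Finset Γ → 𝒜
  selfAdjoint : ∀ K, IsSelfAdjoint (val K)
  mem_loc : ∀ K, val K ∈ S.loc K

/-- The inner local Hamiltonian `H_I`, the sum of `Φ(K)` over `K ⊆ I`. -/
def Potential.innerHamiltonian {S : QuantumSpinSystem Γ 𝒜} (Φ : S.Potential) (I : Finset Γ) : 𝒜 :=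
  ∑ K ∈ I.powerset, Φ.val K

/-- `H` is the surface energy `H_{∂I}`: the sum of `Φ(K)` over all finite `K` that meet both `I` and
its complement converges in norm to `H`, as the limit over the finite regions `Λ` (directed by
inclusion) of the sums over `K ⊆ Λ`. -/
def Potential.HasSurfaceEnergy {S : QuantumSpinSystem Γ 𝒜} (Φ : S.Potential) (I : Finset Γ)
    (H : 𝒜) : Prop :=
  Tendsto (fun Λ : Finset Γ =>
    ∑ K ∈ Λ.powerset with (K ∩ I).Nonempty ∧ (K \ I).Nonempty, Φ.val K) atTop (𝓝 H)

/-- The conditional free energy of `ψ` on `I`, for the potential `Φ` with surface energies `Hsurf`: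
the energy `ψ(H_I + H_{∂I})` (a real number) minus `1/β` times the conditional entropy of `ψ` on `I`
given the complement of `I`. -/
def condFreeEnergy (S : QuantumSpinSystem Γ 𝒜) (Φ : S.Potential) (Hsurf : Finset Γ → 𝒜) (β : ℝ)
    (I : Finset Γ) (ψ : CStarState 𝒜) : EReal :=
  ((ψ (Φ.innerHamiltonian I + Hsurf I)).re : EReal)
    - ((1 / β : ℝ) : EReal) * S.condEntropy ψ I (I : Set Γ)ᶜ

/-- Local thermodynamical stability: for every finite region `I`, the state `φ` minimizes the
conditional free energy on `I` among all states that agree with `φ` on `𝒜(Iᶜ)`. -/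
def IsLTS (S : QuantumSpinSystem Γ 𝒜) (Φ : S.Potential) (Hsurf : Finset Γ → 𝒜) (β : ℝ)
    (φ : CStarState 𝒜) : Prop :=
  ∀ (I : Finset Γ) (ψ : CStarState 𝒜), (∀ X ∈ S.region (I : Set Γ)ᶜ, ψ X = φ X) →
    S.condFreeEnergy Φ Hsurf β I φ ≤ S.condFreeEnergy Φ Hsurf β I ψ

/-- `ω` is the product state `φ_A ⊗ φ_{Aᶜ}` of the restrictions of `φ` to `𝒜(A)` and `𝒜(Aᶜ)`. -/
def IsProductState (S : QuantumSpinSystem Γ 𝒜) (φ : CStarState 𝒜) (A : Finset Γ)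
    (ω : CStarState 𝒜) : Prop :=
  ∀ X ∈ S.loc A, ∀ Y ∈ S.region (A : Set Γ)ᶜ, ω (X * Y) = φ X * φ Y

end QuantumSpinSystem

/-- The cell with index `n` of the partition of `ℤ^ν` into translates of the box
`{x | 0 ≤ x i < a i}`. -/
def latticeCell {ν : ℕ} (a : Fin ν → ℕ) (n : Fin ν → ℤ) : Set (Fin ν → ℤ) :=
  {x | ∀ i, n i * (a i : ℤ) ≤ x i ∧ x i < (n i + 1) * (a i : ℤ)}

/-- The number of cells that are contained in `Λ`. -/
def innerCells {ν : ℕ} (a : Fin ν → ℕ) (Λ : Set (Fin ν → ℤ)) : ℕ :=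
  {n | latticeCell a n ⊆ Λ}.ncard

/-- The number of cells that meet `Λ`. -/
def outerCells {ν : ℕ} (a : Fin ν → ℕ) (Λ : Set (Fin ν → ℤ)) : ℕ :=
  {n | (latticeCell a n ∩ Λ).Nonempty}.ncard

/-- The finite regions `A` tend to infinity in the sense of van Hove along the filter `l`, where the
sites are identified with `ℤ^ν` by `e`: for all box sizes `a`, the number of cells inside `A` tends
to infinity, and its ratio to the number of cells that meet `A` tends to one. -/
def IsVanHove {Γ : Type*} {ν : ℕ} (e : Γ ≃ (Fin ν → ℤ)) (l : Filter (Finset Γ)) : Prop :=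
  ∀ a : Fin ν → ℕ, (∀ i, 0 < a i) →
    Tendsto (fun A : Finset Γ => innerCells a (e '' (A : Set Γ))) l atTop ∧
    Tendsto (fun A : Finset Γ => (innerCells a (e '' (A : Set Γ)) : ℝ) /
      (outerCells a (e '' (A : Set Γ)) : ℝ)) l (𝓝 1)

end

/- An LTS state `φ` is compared with the product state `φ_A ⊗ φ_{Aᶜ}`, which agrees with `φ` on
`𝒜(Aᶜ)` and is thus a competitor in the variational principle for `A`. The two states have the same
inner energy, since they also agree on `𝒜(A)`, and the conditional entropy of the product state is
`S_A(φ)`, because the von Neumann entropy is additive on products. Hence LTS bounds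
`S_A(φ) - S̃_{A|Aᶜ}(φ)` by `β` times the difference of the surface energies. The product state
exists because it arises from `φ` by averaging over the matrix units of `𝒜(A)`, and it is unique
because the elements `X Y` span the local algebras. -/

open scoped ComplexStarModule Kronecker

theorem norm_positiveLinearMap_apply_le {A : Type*} [CStarAlgebra A] [PartialOrder A]
    [StarOrderedRing A] (f : A →ₚ[ℂ] ℂ) (a : A) : ‖f a‖ ≤ ‖f 1‖ * ‖a‖ := by
  have norm_sq_toPreGNS_le (b : A) : ‖f.toPreGNS b‖ ^ 2 ≤ ‖f 1‖ * ‖b‖ ^ 2 := by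
    have h := f.norm_apply_le_of_nonneg _ (star_mul_self_nonneg b)
    have hb : (‖f.toPreGNS b‖ ^ 2 : ℂ) = f (star b * b) := f.preGNS_norm_sq (f.toPreGNS b)
    rwa [CStarRing.norm_star_mul_self, ← hb, ← sq, norm_pow, Complex.norm_real, norm_norm] at h
  have cauchySchwarz : ‖f a‖ ≤ ‖f.toPreGNS 1‖ * ‖f.toPreGNS a‖ := by
    simpa [f.preGNS_inner_def] using norm_inner_le_norm (𝕜 := ℂ) (f.toPreGNS 1) (f.toPreGNS a)
  refine le_of_sq_le_sq ?_ (by positivity)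
  calc ‖f a‖ ^ 2 ≤ (‖f.toPreGNS 1‖ * ‖f.toPreGNS a‖) ^ 2 := by gcongr
    _ = ‖f.toPreGNS 1‖ ^ 2 * ‖f.toPreGNS a‖ ^ 2 := mul_pow ..
    _ ≤ ‖f 1‖ * ‖(1 : A)‖ ^ 2 * (‖f 1‖ * ‖a‖ ^ 2) := by gcongr <;> exact norm_sq_toPreGNS_le _
    _ ≤ ‖f 1‖ * 1 ^ 2 * (‖f 1‖ * ‖a‖ ^ 2) := by
      gcongr
      nontriviality A
      exact CStarRing.norm_one.le
    _ = (‖f 1‖ * ‖a‖) ^ 2 := by ring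

section FunctionalCalculus

variable {A : Type*} [CStarAlgebra A]

theorem cfc_comp_re_mul_im {f : ℝ → ℝ} (hf : Continuous f) (n : A) [IsStarNormal n] :
    cfc (fun z : ℂ => (f (z.re * z.im) : ℂ)) n = cfc f (ℜ n * ℑ n : A) := by
  have hmul : cfc (fun z : ℂ => (z.re : ℂ) * z.im) n = (ℜ n * ℑ n : A) := by
    rw [cfc_mul .., cfc_re_id n, cfc_im_id n]
  have hsa : IsSelfAdjoint (ℜ n * ℑ n : A) :=
    ((ℜ n).2.commute_iff (ℑ n).2).1 (isStarNormal_iff_commute_realPart_imaginaryPart.1 ‹_›)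
  rw [cfc_real_eq_complex, ← hmul, ← cfc_comp' (fun z : ℂ => (f z.re : ℂ)) _ n (by fun_prop)]
  simp

/- Both sides are functions of the normal element `a + i b`, so that the identity reduces to the
scalar one for `Real.negMulLog (x * y)`. -/
theorem cfc_negMulLog_mul {a b : A} (ha : IsSelfAdjoint a) (hb : IsSelfAdjoint b)
    (hab : Commute a b) :
    cfc Real.negMulLog (a * b) = cfc Real.negMulLog a * b + a * cfc Real.negMulLog b := by
  set n := a + Complex.I • b with hn
  have hre : (ℜ n : A) = a := by simp [hn, ha.coe_realPart, hb.imaginaryPart]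
  have him : (ℑ n : A) = b := by simp [hn, hb.coe_realPart, ha.imaginaryPart]
  have : IsStarNormal n := isStarNormal_iff_commute_realPart_imaginaryPart.2 (by rwa [hre, him])
  have hη := Real.continuous_negMulLog
  have hηre : ContinuousOn (fun z : ℂ => (z.re.negMulLog : ℂ)) (spectrum ℂ n) := by fun_prop
  have hηim : ContinuousOn (fun z : ℂ => (z.im.negMulLog : ℂ)) (spectrum ℂ n) := by fun_prop
  calc cfc Real.negMulLog (a * b)
      = cfc (fun z : ℂ => (z.re.negMulLog : ℂ) * z.im + z.re * (z.im.negMulLog : ℂ)) n := by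
        rw [← hre, ← him, ← cfc_comp_re_mul_im hη n]
        refine cfc_congr fun z _ => ?_
        simp only [Real.negMulLog_mul, Complex.ofReal_add, Complex.ofReal_mul]
        ring
    _ = cfc Real.negMulLog a * b + a * cfc Real.negMulLog b := by
        rw [cfc_add .., cfc_mul .., cfc_mul .., cfc_re_id n, cfc_im_id n,
          cfc_comp_re _ n hη.continuousOn, cfc_comp_im _ n hη.continuousOn, hre, him]

end FunctionalCalculus

section Matrix

variable {m n : Type*} [Fintype m] [DecidableEq m] [Fintype n] [DecidableEq n]

/- By Skolem–Noether, the isomorphism is a conjugation. -/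
theorem trace_matrixAlgEquiv_apply {K : Type*} [Field K] (e : Matrix m m K ≃ₐ[K] Matrix n n K)
    (X : Matrix m m K) : (e X).trace = X.trace := by
  obtain ⟨T, hT⟩ := ((Matrix.toLinAlgEquiv'.symm.trans e).trans
    Matrix.toLinAlgEquiv').eq_linearEquivConjAlgEquiv
  have h : Matrix.toLin' (e X) = T.conj (Matrix.toLin' X) := by
    have := congr($hT (Matrix.toLinAlgEquiv' X))
    rwa [AlgEquiv.trans_apply, AlgEquiv.trans_apply, AlgEquiv.symm_apply_apply] at this
  rw [← Matrix.trace_toLin'_eq, h, LinearMap.trace_conj', Matrix.trace_toLin'_eq]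

variable {R : Type*} [CommSemiring R]

theorem sum_single_mul_mul_single (X : Matrix m m R) :
    ∑ k, ∑ l, Matrix.single k l 1 * X * Matrix.single l k 1 = X.trace • (1 : Matrix m m R) := by
  simp only [Matrix.single_mul_mul_single, one_mul, mul_one, Matrix.trace, Matrix.diag]
  ext i j
  simp only [Matrix.sum_apply, Matrix.single_apply, Matrix.smul_apply, Matrix.one_apply]
  by_cases hij : i = j
  · simp [hij]
  · have (k : m) : ¬(k = i ∧ k = j) := fun hk => hij (hk.1.symm.trans hk.2)
    simp [hij, this]

/-- The Kronecker product as an isomorphism of `Mₘ(R) ⊗ Mₙ(R)` with `Mₘₓₙ(R)`, by which the tensor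
product of two local algebras is identified with a full matrix algebra. -/
noncomputable def kroneckerAlgEquiv (m n R : Type*) [Fintype m] [DecidableEq m] [Fintype n]
    [DecidableEq n] [CommSemiring R] :
    Matrix m m R ⊗[R] Matrix n n R ≃ₐ[R] Matrix (m × n) (m × n) R :=
  (Matrix.kroneckerTMulAlgEquiv m n R R R R).trans (Algebra.TensorProduct.lid R R).mapMatrix

theorem kroneckerAlgEquiv_tmul (X : Matrix m m R) (Y : Matrix n n R) :
    kroneckerAlgEquiv m n R (X ⊗ₜ Y) = X ⊗ₖ Y :=
  rfl

theorem linearMap_ext_kronecker {m n : Type*} [Finite m] [Finite n] {M : Type*} [AddCommMonoid M]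
    [Module R M] {f g : Matrix (m × n) (m × n) R →ₗ[R] M}
    (h : ∀ X Y, f (X ⊗ₖ Y) = g (X ⊗ₖ Y)) : f = g := by
  classical
  have := Fintype.ofFinite m
  have := Fintype.ofFinite n
  have : f ∘ₗ (kroneckerAlgEquiv m n R).toLinearMap = g ∘ₗ (kroneckerAlgEquiv m n R).toLinearMap :=
    TensorProduct.ext' h
  exact (LinearMap.cancel_right (kroneckerAlgEquiv m n R).surjective).1 this

end Matrix

/- Where `s = ±∞` the hypothesis is false or the conclusion trivial, so that it suffices to clear
denominators. -/
theorem coe_sub_le_of_coe_sub_mul_le {β x y t : ℝ} (hβ : 0 < β) {s : EReal}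
    (h : (x : EReal) - ((1 / β : ℝ) : EReal) * s ≤ y - ((1 / β : ℝ) : EReal) * t) :
    (t : EReal) - s ≤ ((β * (y - x) : ℝ) : EReal) := by
  induction s with
  | bot =>
    rw [EReal.coe_mul_bot_of_pos (by positivity), EReal.coe_sub_bot, top_le_iff, ← EReal.coe_mul,
      ← EReal.coe_sub] at h
    exact absurd h (EReal.coe_ne_top _)
  | top => simp
  | coe s =>
    norm_cast at h ⊢
    have := mul_le_mul_of_nonneg_left h hβ.le
    field_simp at this
    linarith

namespace CStarState

variable {𝒜 : Type*} [CStarAlgebra 𝒜] (φ ψ : CStarState 𝒜)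

/-- A state as a positive linear map for the order of the C⋆-algebra, which gives access to the
theory of positive linear maps. -/
noncomputable def toPositiveLinearMap [PartialOrder 𝒜] [StarOrderedRing 𝒜] : 𝒜 →ₚ[ℂ] ℂ :=
  .mk₀ φ.toLinearMap fun a ha => by
    obtain ⟨b, rfl⟩ := CStarAlgebra.nonneg_iff_eq_star_mul_self.1 ha
    exact φ.nonneg b

theorem apply_star (a : 𝒜) : φ (star a) = star (φ a) := by
  let := CStarAlgebra.spectralOrder 𝒜
  have := CStarAlgebra.spectralOrderedRing 𝒜
  exact map_star φ.toPositiveLinearMap a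

theorem norm_apply_le (a : 𝒜) : ‖φ a‖ ≤ ‖a‖ := by
  let := CStarAlgebra.spectralOrder 𝒜
  have := CStarAlgebra.spectralOrderedRing 𝒜
  have h : ‖φ a‖ ≤ ‖φ 1‖ * ‖a‖ := norm_positiveLinearMap_apply_le φ.toPositiveLinearMap a
  rwa [φ.map_one, norm_one, one_mul] at h

theorem continuous : Continuous φ :=
  AddMonoidHomClass.continuous_of_bound φ.toLinearMap 1 fun a => by
    simpa only [one_mul] using φ.norm_apply_le a

variable {φ ψ} in
theorem ext_of_dense {s : Set 𝒜} (hs : Dense s) (h : Set.EqOn φ ψ s) : φ = ψ := by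
  have : φ.toLinearMap = ψ.toLinearMap :=
    LinearMap.ext fun a => congrFun (φ.continuous.ext_on hs ψ.continuous h) a
  cases φ
  cases ψ
  simp_all only

theorem mul_re_sub_apply_le {β : ℝ} (hβ : 0 ≤ β) (a : 𝒜) :
    β * (φ a - ψ a).re ≤ 2 * β * ‖a‖ :=
  calc β * (φ a - ψ a).re ≤ β * ‖φ a - ψ a‖ := by gcongr; exact Complex.re_le_norm _
    _ ≤ β * (‖φ a‖ + ‖ψ a‖) := by gcongr; exact norm_sub_le _ _
    _ ≤ β * (‖a‖ + ‖a‖) := by gcongr <;> exact norm_apply_le _ a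
    _ = 2 * β * ‖a‖ := by ring

/-- The state `a ↦ ∑ᵢ φ (Vᵢ a Vᵢ⋆)`, that is, `φ` after the completely positive map with Kraus
operators `Vᵢ⋆`; the product states are of this form. -/
noncomputable def compKraus {ι : Type*} [Fintype ι] (V : ι → 𝒜)
    (hV : φ (∑ i, V i * star (V i)) = 1) : CStarState 𝒜 where
  toLinearMap := ∑ i, φ.toLinearMap ∘ₗ LinearMap.mulLeftRight ℂ (V i, star (V i))
  nonneg a := by
    simp only [LinearMap.sum_apply, LinearMap.comp_apply, LinearMap.mulLeftRight_apply]
    refine Finset.sum_nonneg fun i _ => ?_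
    simpa [mul_assoc] using φ.nonneg (a * star (V i))
  map_one := by simpa using hV

theorem compKraus_apply {ι : Type*} [Fintype ι] {V : ι → 𝒜}
    (hV : φ (∑ i, V i * star (V i)) = 1) (a : 𝒜) :
    φ.compKraus V hV a = φ (∑ i, V i * a * star (V i)) := by
  simp [compKraus]

end CStarState

namespace QuantumSpinSystem

variable {Γ : Type*} [DecidableEq Γ] {𝒜 : Type*} [CStarAlgebra 𝒜] (S : QuantumSpinSystem Γ 𝒜)

section LocalAlgebras

variable {I J : Finset Γ}

/-- The local algebra of a finite region as an embedding of a full matrix algebra into `𝒜`. -/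
noncomputable def emb (I : Finset Γ) : Matrix (Fin (S.dim I)) (Fin (S.dim I)) ℂ →⋆ₐ[ℂ] 𝒜 :=
  (S.loc I).subtype.comp ((S.iso I).symm : _ →⋆ₐ[ℂ] S.loc I)

theorem emb_apply (X : Matrix (Fin (S.dim I)) (Fin (S.dim I)) ℂ) :
    S.emb I X = ((S.iso I).symm X : 𝒜) :=
  rfl

theorem emb_mem (X : Matrix (Fin (S.dim I)) (Fin (S.dim I)) ℂ) : S.emb I X ∈ S.loc I :=
  SetLike.coe_mem ((S.iso I).symm X)

theorem exists_emb_eq {a : 𝒜} (ha : a ∈ S.loc I) : ∃ X, S.emb I X = a :=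
  ⟨S.iso I ⟨a, ha⟩, by simp only [emb_apply, StarAlgEquiv.symm_apply_apply]⟩

theorem emb_injective : Function.Injective (S.emb I) :=
  Subtype.val_injective.comp (S.iso I).symm.injective

theorem cfc_emb {f : ℝ → ℝ} (hf : Continuous f) {X : Matrix (Fin (S.dim I)) (Fin (S.dim I)) ℂ}
    (hX : X.IsHermitian) : cfc f (S.emb I X) = S.emb I (cfc f X) :=
  have hemb : Continuous (S.emb I) :=
    LinearMap.continuous_of_finiteDimensional (S.emb I).toAlgHom.toLinearMap
  ((S.emb I).map_cfc f X hf.continuousOn hemb hX (hX.isSelfAdjoint.map (S.emb I))).symm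

/-- The identification of the matrix algebras behind `𝒜(I) ⊗ 𝒜(J) = 𝒜(I ∪ J)`. -/
noncomputable def unionEquiv (h : Disjoint I J) :
    Matrix (Fin (S.dim I) × Fin (S.dim J)) (Fin (S.dim I) × Fin (S.dim J)) ℂ ≃ₐ[ℂ]
      Matrix (Fin (S.dim (I ∪ J))) (Fin (S.dim (I ∪ J))) ℂ :=
  (kroneckerAlgEquiv (Fin (S.dim I)) (Fin (S.dim J)) ℂ).symm.trans <|
    (Algebra.TensorProduct.congr (S.iso I).symm.toAlgEquiv (S.iso J).symm.toAlgEquiv).trans <|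
      (S.tensor I J h).choose.trans (S.iso (I ∪ J)).toAlgEquiv

theorem emb_unionEquiv_kronecker (h : Disjoint I J)
    (X : Matrix (Fin (S.dim I)) (Fin (S.dim I)) ℂ) (Y : Matrix (Fin (S.dim J)) (Fin (S.dim J)) ℂ) :
    S.emb (I ∪ J) (S.unionEquiv h (X ⊗ₖ Y)) = S.emb I X * S.emb J Y := by
  have := (S.tensor I J h).choose_spec ((S.iso I).symm X) ((S.iso J).symm Y)
  simpa [emb_apply, unionEquiv, ← kroneckerAlgEquiv_tmul] using this

theorem emb_unionEquiv_kronecker_one (h : Disjoint I J)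
    (X : Matrix (Fin (S.dim I)) (Fin (S.dim I)) ℂ) :
    S.emb (I ∪ J) (S.unionEquiv h (X ⊗ₖ 1)) = S.emb I X := by
  rw [emb_unionEquiv_kronecker, map_one, mul_one]

theorem emb_unionEquiv_one_kronecker (h : Disjoint I J)
    (Y : Matrix (Fin (S.dim J)) (Fin (S.dim J)) ℂ) :
    S.emb (I ∪ J) (S.unionEquiv h (1 ⊗ₖ Y)) = S.emb J Y := by
  rw [emb_unionEquiv_kronecker, map_one, one_mul]

theorem loc_mono (h : I ⊆ J) : S.loc I ≤ S.loc J := by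
  intro a ha
  obtain ⟨X, rfl⟩ := S.exists_emb_eq ha
  have := S.emb_mem (S.unionEquiv (Finset.disjoint_sdiff (s := I) (t := J)) (X ⊗ₖ 1))
  rwa [emb_unionEquiv_kronecker_one, Finset.union_sdiff_of_subset h] at this

theorem commute_of_mem_loc (h : Disjoint I J) {a b : 𝒜} (ha : a ∈ S.loc I) (hb : b ∈ S.loc J) :
    Commute a b := by
  obtain ⟨X, rfl⟩ := S.exists_emb_eq ha
  obtain ⟨Y, rfl⟩ := S.exists_emb_eq hb
  rw [← S.emb_unionEquiv_kronecker_one h, ← S.emb_unionEquiv_one_kronecker h]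
  have : Commute (X ⊗ₖ 1) (1 ⊗ₖ Y) := by
    simp only [Commute, SemiconjBy, ← Matrix.mul_kronecker_mul, one_mul, mul_one]
  exact (this.map (S.unionEquiv h)).map (S.emb (I ∪ J))

theorem eqOn_loc_union (h : Disjoint I J) {M : Type*} [AddCommMonoid M] [Module ℂ M]
    {f g : 𝒜 →ₗ[ℂ] M} (hfg : ∀ a ∈ S.loc I, ∀ b ∈ S.loc J, f (a * b) = g (a * b)) :
    Set.EqOn f g (S.loc (I ∪ J)) := by
  let e : Matrix _ _ ℂ →ₗ[ℂ] 𝒜 :=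
    (S.emb (I ∪ J)).toAlgHom.toLinearMap ∘ₗ (S.unionEquiv h).toLinearMap
  have hfge : f ∘ₗ e = g ∘ₗ e := linearMap_ext_kronecker fun X Y => by
    simpa [e, S.emb_unionEquiv_kronecker h X Y] using hfg _ (S.emb_mem X) _ (S.emb_mem Y)
  intro a ha
  obtain ⟨X, rfl⟩ := S.exists_emb_eq ha
  simpa [e] using LinearMap.congr_fun hfge ((S.unionEquiv h).symm X)

variable {R : Set Γ}

theorem loc_subset_region (h : (I : Set Γ) ⊆ R) : (S.loc I : Set 𝒜) ⊆ S.region R :=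
  (Set.subset_iUnion₂ (s := fun (Λ : Finset Γ) (_ : (Λ : Set Γ) ⊆ R) => (S.loc Λ : Set 𝒜))
    I h).trans subset_closure

theorem one_mem_region : (1 : 𝒜) ∈ S.region R :=
  S.loc_subset_region (I := ∅) (by simp) (one_mem _)

theorem commute_of_mem_region {a b : 𝒜} (ha : a ∈ S.loc I) (hb : b ∈ S.region (I : Set Γ)ᶜ) :
    Commute a b := by
  have hcl : IsClosed {b : 𝒜 | a * b = b * a} :=
    isClosed_eq (continuous_const_mul a) (continuous_mul_const a)
  refine closure_minimal (Set.iUnion₂_subset fun Λ hΛ c hc => ?_) hcl hb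
  have hdisj : Disjoint I Λ :=
    Finset.disjoint_coe.1 (Set.subset_compl_iff_disjoint_left.1 hΛ)
  exact S.commute_of_mem_loc hdisj ha hc

end LocalAlgebras

section DensityMatrix

variable (φ ψ : CStarState 𝒜) (I : Finset Γ)

theorem trace_densityMatrix_mul (X : Matrix (Fin (S.dim I)) (Fin (S.dim I)) ℂ) :
    (S.densityMatrix φ I * X).trace = φ (S.emb I X) := by
  let tr : Matrix (Fin (S.dim I)) (Fin (S.dim I)) ℂ →ₗ[ℂ] ℂ :=
    Matrix.traceLinearMap _ ℂ ℂ ∘ₗ LinearMap.mulLeft ℂ (S.densityMatrix φ I)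
  suffices tr = φ.toLinearMap ∘ₗ (S.emb I).toAlgHom.toLinearMap from LinearMap.congr_fun this X
  refine Matrix.ext_linearMap ℂ fun i j => LinearMap.ext_ring ?_
  simp [tr, densityMatrix, emb_apply, Matrix.trace_mul_single]

variable {φ ψ I} in
theorem densityMatrix_eq_iff {D : Matrix (Fin (S.dim I)) (Fin (S.dim I)) ℂ} :
    S.densityMatrix φ I = D ↔ ∀ X, (D * X).trace = φ (S.emb I X) := by
  simp only [← S.trace_densityMatrix_mul, Matrix.ext_iff_trace_mul_right, eq_comm]

theorem trace_densityMatrix : (S.densityMatrix φ I).trace = 1 := by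
  rw [← mul_one (S.densityMatrix φ I), trace_densityMatrix_mul, map_one, φ.map_one]

open scoped MatrixOrder in
theorem posSemidef_densityMatrix : (S.densityMatrix φ I).PosSemidef := by
  refine Matrix.PosSemidef.of_dotProduct_mulVec_nonneg ?_ fun x => ?_
  · ext i j
    simp only [Matrix.conjTranspose_apply, densityMatrix, Matrix.of_apply, ← φ.apply_star,
      ← emb_apply, ← map_star, Matrix.star_eq_conjTranspose, Matrix.conjTranspose_single, star_one]
  · obtain ⟨B, hB⟩ := CStarAlgebra.nonneg_iff_eq_star_mul_self.1
      (Matrix.posSemidef_vecMulVec_self_star x).nonneg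
    calc 0 ≤ φ (star (S.emb I B) * S.emb I B) := φ.nonneg _
      _ = (S.densityMatrix φ I * Matrix.vecMulVec x (star x)).trace := by
        rw [trace_densityMatrix_mul, hB, map_mul (S.emb I), map_star (S.emb I)]
      _ = star x ⬝ᵥ (S.densityMatrix φ I).mulVec x := by
        rw [Matrix.mul_vecMulVec, Matrix.trace_vecMulVec, dotProduct_comm]

end DensityMatrix

section Entropy

variable {φ ψ : CStarState 𝒜} {I J : Finset Γ}

theorem entropy_congr (h : Set.EqOn ψ φ (S.loc I)) : S.entropy ψ I = S.entropy φ I := by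
  have : S.densityMatrix ψ I = S.densityMatrix φ I := (S.densityMatrix_eq_iff).2 fun X => by
    rw [trace_densityMatrix_mul, h (S.emb_mem X)]
  rw [entropy, entropy, this]

theorem densityMatrix_union (hIJ : Disjoint I J)
    (h : ∀ a ∈ S.loc I, ∀ b ∈ S.loc J, φ (a * b) = φ a * φ b) :
    S.densityMatrix φ (I ∪ J) =
      S.unionEquiv hIJ (S.densityMatrix φ I ⊗ₖ S.densityMatrix φ J) := by
  set D := S.densityMatrix φ I ⊗ₖ S.densityMatrix φ J
  have key : Matrix.traceLinearMap _ ℂ ℂ ∘ₗ LinearMap.mulLeft ℂ D = φ.toLinearMap ∘ₗ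
      (S.emb (I ∪ J)).toAlgHom.toLinearMap ∘ₗ (S.unionEquiv hIJ).toLinearMap :=
    linearMap_ext_kronecker fun X Y => by
      simp [D, ← Matrix.mul_kronecker_mul, Matrix.trace_kronecker, trace_densityMatrix_mul,
        emb_unionEquiv_kronecker, h _ (S.emb_mem X) _ (S.emb_mem Y)]
  refine S.densityMatrix_eq_iff.2 fun Z => ?_
  obtain ⟨W, rfl⟩ := (S.unionEquiv hIJ).surjective Z
  rw [← map_mul, trace_matrixAlgEquiv_apply]
  exact LinearMap.congr_fun key W

theorem cfc_negMulLog_unionEquiv_kronecker (hIJ : Disjoint I J)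
    {X : Matrix (Fin (S.dim I)) (Fin (S.dim I)) ℂ} {Y : Matrix (Fin (S.dim J)) (Fin (S.dim J)) ℂ}
    (hX : X.IsHermitian) (hY : Y.IsHermitian) (hXY : (S.unionEquiv hIJ (X ⊗ₖ Y)).IsHermitian) :
    cfc Real.negMulLog (S.unionEquiv hIJ (X ⊗ₖ Y)) =
      S.unionEquiv hIJ (cfc Real.negMulLog X ⊗ₖ Y + X ⊗ₖ cfc Real.negMulLog Y) := by
  apply S.emb_injective
  have hη := Real.continuous_negMulLog
  rw [← S.cfc_emb hη hXY, map_add, map_add]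
  simp only [emb_unionEquiv_kronecker, ← S.cfc_emb hη hX, ← S.cfc_emb hη hY]
  exact cfc_negMulLog_mul (hX.isSelfAdjoint.map (S.emb I)) (hY.isSelfAdjoint.map (S.emb J))
    (S.commute_of_mem_loc hIJ (S.emb_mem X) (S.emb_mem Y))

theorem entropy_union (hIJ : Disjoint I J)
    (h : ∀ a ∈ S.loc I, ∀ b ∈ S.loc J, φ (a * b) = φ a * φ b) :
    S.entropy φ (I ∪ J) = S.entropy φ I + S.entropy φ J := by
  have hD := S.densityMatrix_union hIJ h
  simp only [entropy]
  rw [hD, cfc_negMulLog_unionEquiv_kronecker S hIJ (S.posSemidef_densityMatrix φ I).1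
    (S.posSemidef_densityMatrix φ J).1 (hD ▸ (S.posSemidef_densityMatrix φ (I ∪ J)).1),
    trace_matrixAlgEquiv_apply, Matrix.trace_add, Matrix.trace_kronecker, Matrix.trace_kronecker,
    trace_densityMatrix, trace_densityMatrix, mul_one, one_mul, Complex.add_re]

end Entropy

section ProductState

variable {φ ω ω' : CStarState 𝒜} {A : Finset Γ}

/- With `D = C⋆ C` the density matrix of `φ` on `A`, the Kraus operators `E_{kl} C` average over
all matrix units and thereby replace each `X ∈ 𝒜(A)` by the scalar `Tr (C X C⋆) = φ(X)`. -/
open scoped MatrixOrder in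
theorem exists_kraus_apply_mul (φ : CStarState 𝒜) (A : Finset Γ) :
    ∃ V : Fin (S.dim A) × Fin (S.dim A) → 𝒜, ∀ X ∈ S.loc A, ∀ Y ∈ S.region (A : Set Γ)ᶜ,
      ∑ i, V i * (X * Y) * star (V i) = φ X • Y := by
  obtain ⟨C, hC⟩ :=
    CStarAlgebra.nonneg_iff_eq_star_mul_self.1 (S.posSemidef_densityMatrix φ A).nonneg
  let W (i : Fin (S.dim A) × Fin (S.dim A)) := Matrix.single i.1 i.2 1 * C
  have sum_W (X : Matrix (Fin (S.dim A)) (Fin (S.dim A)) ℂ) :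
      ∑ i, W i * X * star (W i) = φ (S.emb A X) • 1 :=
    calc ∑ i, W i * X * star (W i)
        = ∑ k, ∑ l, Matrix.single k l 1 * (C * X * star C) * Matrix.single l k 1 := by
          simp only [Fintype.sum_prod_type, W, star_mul, Matrix.star_eq_conjTranspose,
            Matrix.conjTranspose_single, star_one, mul_assoc]
      _ = φ (S.emb A X) • 1 := by
          rw [sum_single_mul_mul_single, mul_assoc, Matrix.trace_mul_comm, mul_assoc,
            Matrix.trace_mul_comm, ← hC, trace_densityMatrix_mul]
  refine ⟨fun i => S.emb A (W i), fun X hX Y hY => ?_⟩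
  obtain ⟨X, rfl⟩ := S.exists_emb_eq hX
  have hY (i) : Y * star (S.emb A (W i)) = star (S.emb A (W i)) * Y :=
    (S.commute_of_mem_region (star_mem (S.emb_mem (W i))) hY).eq.symm
  calc ∑ i, S.emb A (W i) * (S.emb A X * Y) * star (S.emb A (W i))
      = S.emb A (∑ i, W i * X * star (W i)) * Y := by
        simp only [mul_assoc, hY, map_sum, map_mul, map_star, Finset.sum_mul]
    _ = φ (S.emb A X) • Y := by rw [sum_W, map_smul, map_one, smul_mul_assoc, one_mul]

theorem exists_isProductState (φ : CStarState 𝒜) (A : Finset Γ) :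
    ∃ ω, S.IsProductState φ A ω := by
  obtain ⟨V, hV⟩ := S.exists_kraus_apply_mul φ A
  have hV1 : φ (∑ i, V i * star (V i)) = 1 := by
    have := hV 1 (one_mem _) 1 S.one_mem_region
    simp only [mul_one, φ.map_one, one_smul] at this
    rw [this, φ.map_one]
  refine ⟨φ.compKraus V hV1, fun X hX Y hY => ?_⟩
  rw [CStarState.compKraus_apply, hV X hX Y hY, map_smul, smul_eq_mul]

namespace IsProductState

variable {S}

theorem eqOn_loc (h : S.IsProductState φ A ω) : Set.EqOn ω φ (S.loc A) := fun X hX => by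
  have := h X hX 1 S.one_mem_region
  rwa [mul_one, φ.map_one, mul_one] at this

theorem eqOn_region (h : S.IsProductState φ A ω) : Set.EqOn ω φ (S.region (A : Set Γ)ᶜ) :=
  fun Y hY => by
    have := h 1 (one_mem _) Y hY
    rwa [one_mul, φ.map_one, one_mul] at this

protected theorem unique (h : S.IsProductState φ A ω) (h' : S.IsProductState φ A ω') :
    ω = ω' := by
  refine CStarState.ext_of_dense S.dense fun a ha => ?_
  obtain ⟨I, ha⟩ := Set.mem_iUnion.1 ha
  have hregion : (S.loc (I \ A) : Set 𝒜) ⊆ S.region (A : Set Γ)ᶜ :=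
    S.loc_subset_region fun i hi => (Finset.mem_sdiff.1 hi).2
  refine S.eqOn_loc_union (Finset.disjoint_sdiff (s := A) (t := I)) (fun X hX Y hY => ?_)
    (S.loc_mono (by simp) ha)
  rw [h X hX Y (hregion hY), h' X hX Y (hregion hY)]

theorem entropy_union (h : S.IsProductState φ A ω) {Λ : Finset Γ}
    (hΛ : (Λ : Set Γ) ⊆ (A : Set Γ)ᶜ) :
    S.entropy ω (A ∪ Λ) = S.entropy φ A + S.entropy ω Λ := by
  have hdisj : Disjoint A Λ := Finset.disjoint_coe.1 (Set.subset_compl_iff_disjoint_left.1 hΛ)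
  rw [← S.entropy_congr h.eqOn_loc]
  refine S.entropy_union hdisj fun X hX Y hY => ?_
  have hY := S.loc_subset_region hΛ hY
  rw [h X hX Y hY, h.eqOn_loc hX, h.eqOn_region hY]

theorem condEntropy_eq (h : S.IsProductState φ A ω) {B : Set Γ} (hB : B ⊆ (A : Set Γ)ᶜ) :
    S.condEntropy ω A B = S.entropy φ A := by
  have hΛ (Λ : Finset Γ) (hΛ : (Λ : Set Γ) ⊆ B) :
      S.entropy ω (A ∪ Λ) - S.entropy ω Λ = S.entropy φ A := by
    rw [h.entropy_union (hΛ.trans hB), add_sub_cancel_right]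
  refine le_antisymm ((iInf₂_le ∅ (by simp)).trans_eq ?_) (le_iInf₂ fun Λ h => ?_)
  · rw [hΛ ∅ (by simp)]
  · rw [hΛ Λ h]

end IsProductState

end ProductState

section MutualEntropy

variable (φ : CStarState 𝒜) (A : Finset Γ) {B C : Set Γ}

/- Additivity for `∅ = ∅ ∪ ∅` in a product state `φ_∅ ⊗ φ` gives `S_∅ = S_∅(φ) + S_∅`. -/
theorem entropy_empty : S.entropy φ ∅ = 0 := by
  obtain ⟨ω, h⟩ := S.exists_isProductState φ ∅
  simpa using h.entropy_union (Λ := ∅) (by simp)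

theorem condEntropy_anti (h : B ⊆ C) : S.condEntropy φ A C ≤ S.condEntropy φ A B :=
  le_iInf₂ fun Λ hΛ => iInf₂_le Λ (hΛ.trans h)

theorem mutualEntropy_mono (h : B ⊆ C) : S.mutualEntropy φ A B ≤ S.mutualEntropy φ A C :=
  EReal.sub_le_sub le_rfl (S.condEntropy_anti φ A h)

theorem condEntropy_le_entropy (B : Set Γ) : S.condEntropy φ A B ≤ S.entropy φ A := by
  refine (iInf₂_le ∅ (by simp)).trans_eq ?_
  rw [Finset.union_empty, entropy_empty, sub_zero]

theorem mutualEntropy_nonneg (B : Set Γ) : 0 ≤ S.mutualEntropy φ A B :=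
  (EReal.sub_nonneg (by simp) (by simp)).2 (S.condEntropy_le_entropy φ A B)

end MutualEntropy

section ThermalStability

theorem innerHamiltonian_mem (Φ : S.Potential) (I : Finset Γ) :
    Φ.innerHamiltonian I ∈ S.loc I :=
  sum_mem fun K hK => S.loc_mono (Finset.mem_powerset.1 hK) (Φ.mem_loc K)

namespace IsLTS

variable {S} {Φ : S.Potential} {Hsurf : Finset Γ → 𝒜} {β : ℝ} {φ ω : CStarState 𝒜} {A : Finset Γ}

theorem mutualEntropy_le (hβ : 0 < β) (hφ : S.IsLTS Φ Hsurf β φ) (h : S.IsProductState φ A ω) :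
    S.mutualEntropy φ A (A : Set Γ)ᶜ ≤ ((β * (ω (Hsurf A) - φ (Hsurf A)).re : ℝ) : EReal) := by
  have hle := hφ A ω h.eqOn_region
  rw [condFreeEnergy, condFreeEnergy, h.condEntropy_eq subset_rfl] at hle
  have henergy : (ω (Hsurf A) - φ (Hsurf A)).re = (ω (Φ.innerHamiltonian A + Hsurf A)).re -
      (φ (Φ.innerHamiltonian A + Hsurf A)).re := by
    simp [h.eqOn_loc (S.innerHamiltonian_mem Φ A)]
  rw [mutualEntropy, henergy]
  exact coe_sub_le_of_coe_sub_mul_le hβ hle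

theorem mutualEntropy_le_norm (hβ : 0 < β) (hφ : S.IsLTS Φ Hsurf β φ) (A : Finset Γ) :
    S.mutualEntropy φ A (A : Set Γ)ᶜ ≤ ((2 * β * ‖Hsurf A‖ : ℝ) : EReal) := by
  obtain ⟨ω, h⟩ := S.exists_isProductState φ A
  refine (hφ.mutualEntropy_le hβ h).trans (EReal.coe_le_coe ?_)
  exact ω.mul_re_sub_apply_le φ hβ.le (Hsurf A)

theorem tendsto_mutualEntropy_div_card (hβ : 0 < β) (hφ : S.IsLTS Φ Hsurf β φ)
    {l : Filter (Finset Γ)} (hl : Tendsto (fun A => ‖Hsurf A‖ / (A.card : ℝ)) l (𝓝 0)) :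
    Tendsto (fun A => S.mutualEntropy φ A (A : Set Γ)ᶜ / ((A.card : ℝ) : EReal)) l (𝓝 0) := by
  have hbound : Tendsto (fun A => ((2 * β * (‖Hsurf A‖ / (A.card : ℝ)) : ℝ) : EReal)) l (𝓝 0) := by
    rw [← EReal.coe_zero, EReal.tendsto_coe]
    simpa using hl.const_mul (2 * β)
  refine tendsto_of_tendsto_of_tendsto_of_le_of_le tendsto_const_nhds hbound
    (fun A => EReal.div_nonneg (S.mutualEntropy_nonneg φ A _) (by positivity)) fun A => ?_
  calc S.mutualEntropy φ A (A : Set Γ)ᶜ / ((A.card : ℝ) : EReal)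
      ≤ ((2 * β * ‖Hsurf A‖ : ℝ) : EReal) / ((A.card : ℝ) : EReal) :=
        EReal.div_le_div_right_of_nonneg (by positivity) (hφ.mutualEntropy_le_norm hβ A)
    _ = ((2 * β * (‖Hsurf A‖ / (A.card : ℝ)) : ℝ) : EReal) := by
        rw [← EReal.coe_div, mul_div_assoc]

end IsLTS

end ThermalStability

end QuantumSpinSystem

theorem theorem1_general {Γ : Type*} [DecidableEq Γ] {𝒜 : Type*} [CStarAlgebra 𝒜]
    (S : QuantumSpinSystem Γ 𝒜) (Φ : S.Potential) (Hsurf : Finset Γ → 𝒜)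
    (_hsurf : ∀ I : Finset Γ, Φ.HasSurfaceEnergy I (Hsurf I))
    (β : ℝ) (hβ : 0 < β) (φ : CStarState 𝒜) (hφ : S.IsLTS Φ Hsurf β φ) :
    (∀ A : Finset Γ, ∃! ω : CStarState 𝒜, S.IsProductState φ A ω) ∧
    (∀ (A : Finset Γ) (ω : CStarState 𝒜), S.IsProductState φ A ω →
      (∀ B : Set Γ, B ⊆ (A : Set Γ)ᶜ →
        S.mutualEntropy φ A B ≤ S.mutualEntropy φ A (A : Set Γ)ᶜ) ∧
      S.mutualEntropy φ A (A : Set Γ)ᶜ ≤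
        ((β * (ω (Hsurf A) - φ (Hsurf A)).re : ℝ) : EReal) ∧
      β * (ω (Hsurf A) - φ (Hsurf A)).re ≤ 2 * β * ‖Hsurf A‖) ∧
    (∀ l : Filter (Finset Γ),
      Tendsto (fun A : Finset Γ => ‖Hsurf A‖ / (A.card : ℝ)) l (𝓝 0) →
      Tendsto (fun A : Finset Γ =>
        S.mutualEntropy φ A (A : Set Γ)ᶜ / ((A.card : ℝ) : EReal)) l (𝓝 0)) := by
  refine ⟨fun A => ?_, fun A ω h => ⟨fun B hB => S.mutualEntropy_mono φ A hB,
    hφ.mutualEntropy_le hβ h, ω.mul_re_sub_apply_le φ hβ.le (Hsurf A)⟩,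
    fun l hl => hφ.tendsto_mutualEntropy_div_card hβ hl⟩
  obtain ⟨ω, h⟩ := S.exists_isProductState φ A
  exact ⟨ω, h, fun ω' h' => h'.unique h⟩

theorem theorem1 {Γ : Type*} [DecidableEq Γ] {𝒜 : Type*} [CStarAlgebra 𝒜]
    (S : QuantumSpinSystem Γ 𝒜) (Φ : S.Potential) (Hsurf : Finset Γ → 𝒜)
    (hsurf : ∀ I : Finset Γ, Φ.HasSurfaceEnergy I (Hsurf I))
    (β : ℝ) (hβ : 0 < β) (φ : CStarState 𝒜) (hφ : S.IsLTS Φ Hsurf β φ) :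
    (∀ A : Finset Γ, ∃! ω : CStarState 𝒜, S.IsProductState φ A ω) ∧
    (∀ (A : Finset Γ) (ω : CStarState 𝒜), S.IsProductState φ A ω →
      (∀ B : Set Γ, B ⊆ (A : Set Γ)ᶜ →
        S.mutualEntropy φ A B ≤ S.mutualEntropy φ A (A : Set Γ)ᶜ) ∧
      S.mutualEntropy φ A (A : Set Γ)ᶜ ≤
        ((β * (ω (Hsurf A) - φ (Hsurf A)).re : ℝ) : EReal) ∧
      β * (ω (Hsurf A) - φ (Hsurf A)).re ≤ 2 * β * ‖Hsurf A‖) ∧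
    (∀ (ν : ℕ), 0 < ν → ∀ (e : Γ ≃ (Fin ν → ℤ)) (l : Filter (Finset Γ)), IsVanHove e l →
      Tendsto (fun A : Finset Γ => ‖Hsurf A‖ / (A.card : ℝ)) l (𝓝 0) →
      Tendsto (fun A : Finset Γ =>
        S.mutualEntropy φ A (A : Set Γ)ᶜ / ((A.card : ℝ) : EReal)) l (𝓝 0)) := by
  obtain ⟨hunique, hbound, htendsto⟩ := theorem1_general S Φ Hsurf hsurf β hβ φ hφ
  exact ⟨hunique, hbound, fun _ _ _ l _ => htendsto l⟩
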